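/- Let $Q$ be an involutive poset, that is, a poset with an involution $C:Q\to Q$ that is monotone or antitone. Let $\Delta(Q)$ be its order complex (the simplicial complex of nonempty finite chains of $Q$), and let $Chain(Q)$ be the poset of nonempty finite chains of $Q$, ordered by reversed inclusion, with the involution $\{x_1,\dots,x_k\}\mapsto\{Cx_1,\dots,Cx_k\}$. The geometric realizations $|\Delta(Q)|$ and $|\Delta(Chain(Q))|$ carry their usual (weak) topology and the $\mathbb{Z}_2$-actions induced by these involutions, e.g. $\omega(\sum_j t_jx_j)=\sum_j t_jC(x_j)$ on $|\Delta(Q)|$. There is exactly one map $\Gamma:|\Delta(Q)|\to|\Delta(Chain(Q))|$ with the following property: if $t=t_1x_1+\dots+t_kx_k\in|\Delta(Q)|$, where $x_1,\dots,x_k$ are distinct elements that form a chain of $Q$, listed so that $t_1\ge t_2\ge\dots\ge t_k\ge 0$, and $X_j=\{x_1,\dots,x_j\}$, then $\Gamma(t)=s_1X_1+\dots+s_kX_k$, where the real numbers $s_1,\dots,s_k$ are determined by $$s_1x_1+s_2\frac{x_1+x_2}{2}+\dots+s_k\frac{x_1+\dots+x_k}{k}=t_1x_1+\dots+t_kx_k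 .$$ This canonical map $\Gamma$ is a homeomorphism, it is $\mathbb{Z}_2$-equivariant, i.e. $\Gamma(\omega t)=\omega\,\Gamma(t)$ for all $t$, and it is a $\mathbb{Z}_2$-homotopy equivalence: there is a continuous equivariant map $g$ in the opposite direction such that $g\circ\Gamma$ and $\Gamma\circ g$ are homotopic to the identity maps through equivariant maps. In particular the $\mathbb{Z}_2$-complexes $\Delta(Q)$ and $\Delta(Chain(Q))$ are $\mathbb{Z}_2$-homotopy equivalent. -/

import Mathlib

/-! ### Geometric realization of an abstract simplicial complex -/

/-- A point of the geometric realization `|K|`, in barycentric coordinates: a formal convex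
combination of vertices whose support is a face of `K`. -/
@[ext]
structure Realization {V : Type*} (K : AbstractSimplicialComplex V) where
  /-- the barycentric coordinates -/
  coord : V →₀ ℝ
  nonneg : ∀ v, 0 ≤ coord v
  sum_eq_one : (coord.sum fun _ a => a) = 1
  support_mem : coord.support ∈ K.faces

namespace Realization

variable {V : Type*} {K : AbstractSimplicialComplex V}

/-- The closed geometric simplex of `|K|` spanned by a finite set `σ` of vertices. -/
def ClosedSimplex (K : AbstractSimplicialComplex V) (σ : Finset V) : Type _ :=
  {t : Realization K // t.coord.support ⊆ σ}

/-- The Euclidean topology of a closed simplex: convergence of all barycentric coordinates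
(those outside of the finite set `σ` vanish). -/
instance (σ : Finset V) : TopologicalSpace (ClosedSimplex K σ) :=
  TopologicalSpace.induced (fun t (v : V) => t.1.coord v) inferInstance

/-- The inclusion of a closed simplex in `|K|`. -/
def ClosedSimplex.incl (σ : Finset V) : ClosedSimplex K σ → Realization K := Subtype.val

/-- The usual (weak, coherent) topology of `|K|`: a set is open iff its intersection with every
closed simplex of `K` is open in that simplex. -/
instance : TopologicalSpace (Realization K) :=
  ⨆ σ : {σ : Finset V // σ ∈ K.faces},
    TopologicalSpace.coinduced (ClosedSimplex.incl σ.1) inferInstance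

theorem isOpen_iff {U : Set (Realization K)} :
    IsOpen U ↔ ∀ σ ∈ K.faces, IsOpen (ClosedSimplex.incl (K := K) σ ⁻¹' U) := by
  rw [isOpen_iSup_iff]
  simp only [isOpen_coinduced, Subtype.forall]

theorem continuous_iff {Y : Type*} [TopologicalSpace Y] {f : Realization K → Y} :
    Continuous f ↔ ∀ σ ∈ K.faces, Continuous (f ∘ ClosedSimplex.incl (K := K) σ) := by
  rw [continuous_iSup_dom]
  simp only [continuous_coinduced_dom, Subtype.forall]

theorem continuous_incl {σ : Finset V} (hσ : σ ∈ K.faces) :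
    Continuous (ClosedSimplex.incl (K := K) σ) :=
  continuous_iff.1 continuous_id σ hσ

end Realization

/-! ### `ℤ/2`-spaces -/

/-- A continuous involution of a topological space, that is, a structure of `ℤ/2`-space. -/
structure Z2Action (X : Type*) [TopologicalSpace X] where
  /-- the involution -/
  toFun : X → X
  continuous_toFun : Continuous toFun
  involutive : Function.Involutive toFun

instance {X : Type*} [TopologicalSpace X] : CoeFun (Z2Action X) fun _ => X → X :=
  ⟨Z2Action.toFun⟩

section Z2

variable {X Y : Type*} [TopologicalSpace X] [TopologicalSpace Y]

/-- `f (ω x) = ω (f x)` for all `x`. -/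
def IsEquivariant (ωX : Z2Action X) (ωY : Z2Action Y) (f : X → Y) : Prop :=
  ∀ x, f (ωX x) = ωY (f x)

/-- `f` and `g` are homotopic through equivariant maps. -/
def Z2Homotopic (ωX : Z2Action X) (ωY : Z2Action Y) (f g : C(X, Y)) : Prop :=
  ContinuousMap.HomotopicWith f g fun h => IsEquivariant ωX ωY h

/-- `f` is a `ℤ/2`-equivalence: a `ℤ/2`-map with an inverse up to `ℤ/2`-homotopy that is a
`ℤ/2`-map. -/
def IsZ2Equivalence (ωX : Z2Action X) (ωY : Z2Action Y) (f : C(X, Y)) : Prop :=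
  IsEquivariant ωX ωY f ∧ ∃ g : C(Y, X), IsEquivariant ωY ωX g ∧
    Z2Homotopic ωX ωX (g.comp f) (ContinuousMap.id X) ∧
    Z2Homotopic ωY ωY (f.comp g) (ContinuousMap.id Y)

/-- The two `ℤ/2`-spaces are `ℤ/2`-homotopy equivalent. -/
def Z2HomotopyEquivalent (ωX : Z2Action X) (ωY : Z2Action Y) : Prop :=
  ∃ f : C(X, Y), IsZ2Equivalence ωX ωY f

end Z2

/-! ### Order complexes and chain posets -/

/-- The order complex `Δ(Q)`: its vertices are the elements of `Q`, its faces are the nonempty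
finite chains of `Q`. -/
def orderComplex (Q : Type*) [PartialOrder Q] : AbstractSimplicialComplex Q where
  faces := {s | s.Nonempty ∧ IsChain (· ≤ ·) (s : Set Q)}
  isRelLowerSet_faces := fun _ hs =>
    ⟨hs.1, fun _ hts ht => ⟨ht, hs.2.mono (Finset.coe_subset.2 hts)⟩⟩
  singleton_mem := fun v => ⟨Finset.singleton_nonempty v, by simp⟩

/-- The underlying set of the face poset `Φ(K)`: the (nonempty) faces of `K`. -/
def FacePoset {V : Type*} (K : AbstractSimplicialComplex V) : Type _ :=
  {s : Finset V // s ∈ K.faces}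

/-- The faces are ordered by reversed inclusion. -/
instance {V : Type*} (K : AbstractSimplicialComplex V) : PartialOrder (FacePoset K) where
  le s t := t.1 ⊆ s.1
  le_refl s := Finset.Subset.refl s.1
  le_trans _ _ _ h₁ h₂ := Finset.Subset.trans h₂ h₁
  le_antisymm _ _ h₁ h₂ := Subtype.ext (Finset.Subset.antisymm h₂ h₁)

/-- The chain poset `Chain(Q) = Φ(Δ(Q))`. -/
abbrev ChainPoset (Q : Type*) [PartialOrder Q] : Type _ := FacePoset (orderComplex Q)

/-! ### Involutive posets -/

/-- An involution of the poset `Q` that is monotone or antitone, that is, a structure of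
involutive poset on `Q`. -/
structure PosetInvolution (Q : Type*) [PartialOrder Q] where
  /-- the involution -/
  toFun : Q → Q
  involutive : Function.Involutive toFun
  monotone_or_antitone : Monotone toFun ∨ Antitone toFun

namespace PosetInvolution

variable {Q : Type*} [PartialOrder Q]

instance : CoeFun (PosetInvolution Q) fun _ => Q → Q := ⟨PosetInvolution.toFun⟩

/-- The involution as an embedding. -/
def emb (C : PosetInvolution Q) : Q ↪ Q := ⟨C.toFun, C.involutive.injective⟩

theorem map_emb_map_emb (C : PosetInvolution Q) (s : Finset Q) :
    (s.map C.emb).map C.emb = s := by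
  ext x
  simp only [Finset.mem_map, emb, Function.Embedding.coeFn_mk]
  constructor
  · rintro ⟨_, ⟨y, hy, rfl⟩, rfl⟩
    rwa [C.involutive y]
  · exact fun hx => ⟨C x, ⟨x, hx, rfl⟩, C.involutive x⟩

theorem map_mem_faces (C : PosetInvolution Q) {s : Finset Q} (hs : s ∈ (orderComplex Q).faces) :
    s.map C.emb ∈ (orderComplex Q).faces := by
  refine ⟨hs.1.map, ?_⟩
  rintro _ hx _ hy -
  simp only [Finset.coe_map, Set.mem_image, Finset.mem_coe] at hx hy
  obtain ⟨x, hx, rfl⟩ := hx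
  obtain ⟨y, hy, rfl⟩ := hy
  rcases C.monotone_or_antitone with h | h <;> rcases hs.2.total hx hy with hxy | hxy
  · exact Or.inl (h hxy)
  · exact Or.inr (h hxy)
  · exact Or.inr (h hxy)
  · exact Or.inl (h hxy)

/-- The induced involution of `Chain(Q)`: it maps the chain `{x₁, …, xₖ}` to
`{C x₁, …, C xₖ}`. -/
def chain (C : PosetInvolution Q) : PosetInvolution (ChainPoset Q) where
  toFun A := ⟨A.1.map C.emb, C.map_mem_faces A.2⟩
  involutive A := Subtype.ext (C.map_emb_map_emb A.1)
  monotone_or_antitone := Or.inl fun _ _ h => Finset.map_subset_map.2 h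

theorem support_mapDomain (C : PosetInvolution Q) (t : Q →₀ ℝ) :
    (Finsupp.mapDomain C t).support = t.support.map C.emb := by
  classical
  rw [Finsupp.mapDomain_support_of_injective C.involutive.injective, Finset.map_eq_image]
  rfl

theorem mapDomain_apply (C : PosetInvolution Q) (t : Q →₀ ℝ) (x : Q) :
    Finsupp.mapDomain C t x = t (C x) := by
  conv_lhs => rw [← C.involutive x]
  exact Finsupp.mapDomain_apply C.involutive.injective t (C x)

/-- The induced map of `|Δ(Q)|`: it sends `∑ tⱼ xⱼ` to `∑ tⱼ C(xⱼ)`. -/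
noncomputable def realizationMap (C : PosetInvolution Q) (t : Realization (orderComplex Q)) :
    Realization (orderComplex Q) where
  coord := Finsupp.mapDomain C t.coord
  nonneg x := by rw [mapDomain_apply]; exact t.nonneg _
  sum_eq_one := by
    rw [Finsupp.sum_mapDomain_index (fun _ => rfl) (fun _ _ _ => rfl)]
    exact t.sum_eq_one
  support_mem := by rw [support_mapDomain]; exact C.map_mem_faces t.support_mem

theorem continuous_realizationMap (C : PosetInvolution Q) : Continuous C.realizationMap := by
  refine Realization.continuous_iff.2 fun σ hσ => ?_
  let g : Realization.ClosedSimplex (orderComplex Q) σ →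
      Realization.ClosedSimplex (orderComplex Q) (σ.map C.emb) := fun t =>
    ⟨C.realizationMap t.1, by
      change (Finsupp.mapDomain C t.1.coord).support ⊆ _
      rw [support_mapDomain]
      exact Finset.map_subset_map.2 t.2⟩
  have hg : Continuous g := by
    refine continuous_induced_rng.2 (continuous_pi fun x => ?_)
    have h : Continuous fun t : Realization.ClosedSimplex (orderComplex Q) σ =>
        t.1.coord (C x) :=
      (continuous_apply (C x)).comp continuous_induced_dom
    refine h.congr fun t => ?_
    exact (C.mapDomain_apply t.1.coord x).symm
  exact (Realization.continuous_incl (C.map_mem_faces hσ)).comp hg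

/-- The induced `ℤ/2`-action on `|Δ(Q)|`. -/
noncomputable def realization (C : PosetInvolution Q) :
    Z2Action (Realization (orderComplex Q)) where
  toFun := C.realizationMap
  continuous_toFun := C.continuous_realizationMap
  involutive t := by
    ext x
    change Finsupp.mapDomain C (Finsupp.mapDomain C t.coord) x = t.coord x
    rw [mapDomain_apply, mapDomain_apply, C.involutive x]

end PosetInvolution

/-! ### The canonical map to the barycentric subdivision -/

section Barycentric

variable {Q : Type*} [PartialOrder Q]

/-- The barycentre `(x₁ + ⋯ + xₘ) / m` of a nonempty finite chain `{x₁, …, xₘ}`. -/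
noncomputable def barycentre (A : ChainPoset Q) : Q →₀ ℝ :=
  ∑ x ∈ A.1, Finsupp.single x ((A.1.card : ℝ)⁻¹)

/-- For an injective enumeration `x₀, …, xₖ₋₁` of a chain (in any order), the subchain
`{x₀, …, xⱼ}`. -/
def prefixChain {k : ℕ} (x : Fin k ↪ Q) (hx : IsChain (· ≤ ·) (Set.range x)) (j : Fin k) :
    ChainPoset Q :=
  ⟨(Finset.Iic j).map x, ⟨⟨x j, Finset.mem_map_of_mem x (Finset.mem_Iic.2 le_rfl)⟩,
    hx.mono (by rw [Finset.coe_map]; exact Set.image_subset_range _ _)⟩⟩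

/-- `Γ : |Δ(Q)| → |Δ(Chain(Q))|` is the canonical map: whenever the vertices of a simplex
containing `t` are listed as `x₀, …, xₖ₋₁` so that the coefficients of `t` descend, one has
`Γ t = ∑ sⱼ Xⱼ` where `Xⱼ = {x₀, …, xⱼ}` and the `sⱼ` are such that
`∑ sⱼ (x₀ + ⋯ + xⱼ) / (j + 1) = t`. -/
def IsBarycentricMap (Γ : Realization (orderComplex Q) →
    Realization (orderComplex (ChainPoset Q))) : Prop :=
  ∀ (t : Realization (orderComplex Q)) (k : ℕ) (x : Fin k ↪ Q)
    (hx : IsChain (· ≤ ·) (Set.range x)),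
    (t.coord.support : Set Q) ⊆ Set.range x → (Antitone fun j => t.coord (x j)) →
    ∃ s : Fin k → ℝ,
      ∑ j, s j • barycentre (prefixChain x hx j) = t.coord ∧
      (Γ t).coord = ∑ j, Finsupp.single (prefixChain x hx j) (s j)

end Barycentric

/-!
The canonical map is the inverse of the affine map `|Δ(Chain(Q))| → |Δ(Q)|` which sends each
vertex `A` to the barycentre of the chain `A`. The point is a formula for this inverse that does
not mention an ordering of the vertices: if the support of `t` is contained in the finite set
`σ`, then the coefficient of `A` in the preimage of `t` is
`gap σ A t = |A| · max (0, min_A t - max_{σ \ A} t)`.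

Two inequalities prove this. If `u` is any point over `t`, then `u A ≤ gap σ A t`, because every
chain in the support of `u` that meets the complement of `A` contains `A`
(`coord_le_gap`). If the coefficients of `t` descend along `x₀, …, xₖ₋₁`, then Abel summation
gives a point `v` over `t` with coefficients `(j + 1) (t xⱼ - t xⱼ₊₁)` at `{x₀, …, xⱼ}`, and
`gap σ A t ≤ v A`, because `A` is such a prefix as soon as its gap is positive
(`gap_le_descending`). As the coefficients of `u` and of `v` both have sum one, `u = v`.

Since the gaps depend continuously on `t`, each closed simplex of `|Δ(Q)|` is covered by the
finitely many closed sets of points whose image lies in a given simplex of `|Δ(Chain(Q))|`, and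
the inverse is continuous on each of them.
-/

theorem Realization.ClosedSimplex.continuous_coord {V : Type*} {K : AbstractSimplicialComplex V}
    (σ : Finset V) (v : V) :
    Continuous fun t : Realization.ClosedSimplex K σ => t.1.coord v :=
  (continuous_apply v).comp continuous_induced_dom

theorem Finsupp.support_nonempty_of_sum_eq_one {V : Type*} {t : V →₀ ℝ}
    (h : (t.sum fun _ a => a) = 1) : t.support.Nonempty := by
  rw [Finsupp.support_nonempty_iff]
  rintro rfl
  simp at h

/-! ### The affine map that sends a chain to its barycentre -/

section Affine

variable {Q : Type*} [PartialOrder Q]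

theorem card_pos_of_chain (A : ChainPoset Q) : (0 : ℝ) < A.1.card :=
  Nat.cast_pos.2 (Finset.card_pos.2 A.2.1)

theorem barycentre_apply_of_mem {A : ChainPoset Q} {x : Q} (h : x ∈ A.1) :
    barycentre A x = (A.1.card : ℝ)⁻¹ := by
  classical
  simp [barycentre, Finsupp.finsetSum_apply, Finsupp.single_apply, h]

theorem barycentre_apply_of_notMem {A : ChainPoset Q} {x : Q} (h : x ∉ A.1) :
    barycentre A x = 0 := by
  classical
  simp [barycentre, Finsupp.finsetSum_apply, Finsupp.single_apply, h]

theorem barycentre_nonneg (A : ChainPoset Q) (x : Q) : 0 ≤ barycentre A x := by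
  by_cases h : x ∈ A.1
  · rw [barycentre_apply_of_mem h]; positivity
  · rw [barycentre_apply_of_notMem h]

/-- The sum of all coefficients, as a linear form. -/
noncomputable def coeffSum (V : Type*) : (V →₀ ℝ) →ₗ[ℝ] ℝ :=
  Finsupp.linearCombination ℝ fun _ => 1

theorem coeffSum_apply {V : Type*} (t : V →₀ ℝ) : coeffSum V t = t.sum fun _ a => a := by
  simp [coeffSum, Finsupp.linearCombination_apply]

theorem coeffSum_barycentre (A : ChainPoset Q) : coeffSum Q (barycentre A) = 1 := by
  have h := (card_pos_of_chain A).ne'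
  simp [barycentre, coeffSum, h]

/-- The linear extension of `A ↦ barycentre A`. -/
noncomputable def barycentreLinear (Q : Type*) [PartialOrder Q] :
    (ChainPoset Q →₀ ℝ) →ₗ[ℝ] (Q →₀ ℝ) :=
  Finsupp.linearCombination ℝ barycentre

theorem barycentreLinear_single (A : ChainPoset Q) (a : ℝ) :
    barycentreLinear Q (Finsupp.single A a) = a • barycentre A := by
  simp [barycentreLinear]

theorem coeffSum_barycentreLinear (u : ChainPoset Q →₀ ℝ) :
    coeffSum Q (barycentreLinear Q u) = coeffSum _ u := by
  induction u using Finsupp.induction_linear with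
  | zero => simp
  | add f g hf hg => rw [map_add, map_add, map_add, hf, hg]
  | single A a =>
    rw [barycentreLinear_single, map_smul, coeffSum_barycentre]
    simp [coeffSum]

theorem barycentreLinear_apply_of_subset {u : ChainPoset Q →₀ ℝ} {τ : Finset (ChainPoset Q)}
    (h : u.support ⊆ τ) (x : Q) :
    barycentreLinear Q u x = ∑ A ∈ τ, u A * barycentre A x := by
  rw [barycentreLinear, Finsupp.linearCombination_apply,
    Finsupp.sum_of_support_subset _ h _ (by simp), Finsupp.finsetSum_apply]
  simp

theorem exists_mem_of_barycentreLinear_ne_zero {u : ChainPoset Q →₀ ℝ} {x : Q}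
    (h : barycentreLinear Q u x ≠ 0) : ∃ A ∈ u.support, x ∈ A.1 := by
  rw [barycentreLinear_apply_of_subset subset_rfl] at h
  obtain ⟨A, hA, hne⟩ := Finset.exists_ne_zero_of_sum_ne_zero h
  refine ⟨A, hA, ?_⟩
  by_contra hx
  exact hne (by rw [barycentre_apply_of_notMem hx, mul_zero])

theorem exists_subset_of_mem_faces {τ : Finset (ChainPoset Q)}
    (hτ : τ ∈ (orderComplex (ChainPoset Q)).faces) : ∃ B ∈ τ, ∀ A ∈ τ, A.1 ⊆ B.1 := by
  obtain ⟨B, hB⟩ := τ.exists_minimal hτ.1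
  exact ⟨B, hB.1, fun A hA => (hτ.2.total hB.1 hA).elim id fun h => hB.2 hA h⟩

/-- The affine map `|Δ(Chain(Q))| → |Δ(Q)|` that sends each vertex `A` to the barycentre
of `A`. -/
noncomputable def realizeBarycentres (u : Realization (orderComplex (ChainPoset Q))) :
    Realization (orderComplex Q) where
  coord := barycentreLinear Q u.coord
  nonneg x := by
    rw [barycentreLinear_apply_of_subset subset_rfl]
    exact Finset.sum_nonneg fun A _ => mul_nonneg (u.nonneg A) (barycentre_nonneg A x)
  sum_eq_one := by
    rw [← coeffSum_apply, coeffSum_barycentreLinear, coeffSum_apply, u.sum_eq_one]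
  support_mem := by
    obtain ⟨B, -, hB⟩ := exists_subset_of_mem_faces u.support_mem
    refine ⟨Finsupp.support_nonempty_of_sum_eq_one ?_, B.2.2.mono fun x hx => ?_⟩
    · rw [← coeffSum_apply, coeffSum_barycentreLinear, coeffSum_apply, u.sum_eq_one]
    · obtain ⟨A, hA, hxA⟩ := exists_mem_of_barycentreLinear_ne_zero (Finsupp.mem_support_iff.1 hx)
      exact hB A hA hxA

theorem continuous_realizeBarycentres : Continuous (realizeBarycentres (Q := Q)) := by
  refine Realization.continuous_iff.2 fun τ hτ => ?_
  obtain ⟨B, -, hB⟩ := exists_subset_of_mem_faces hτ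
  let g : Realization.ClosedSimplex (orderComplex (ChainPoset Q)) τ →
      Realization.ClosedSimplex (orderComplex Q) B.1 := fun u =>
    ⟨realizeBarycentres u.1, fun x hx => by
      obtain ⟨A, hA, hxA⟩ := exists_mem_of_barycentreLinear_ne_zero (Finsupp.mem_support_iff.1 hx)
      exact hB A (u.2 hA) hxA⟩
  have hg : Continuous g := by
    refine continuous_induced_rng.2 (continuous_pi fun x => ?_)
    have h : Continuous fun u : Realization.ClosedSimplex (orderComplex (ChainPoset Q)) τ =>
        ∑ A ∈ τ, u.1.coord A * barycentre A x :=
      continuous_finsetSum _ fun A _ =>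
        (Realization.ClosedSimplex.continuous_coord τ A).mul continuous_const
    exact h.congr fun u => (barycentreLinear_apply_of_subset u.2 x).symm
  exact (Realization.continuous_incl B.2).comp hg

/-- A chain in the support of `u` lies in the support of its image. -/
theorem subset_support_realizeBarycentres (u : Realization (orderComplex (ChainPoset Q)))
    {A : ChainPoset Q} (hA : A ∈ u.coord.support) :
    A.1 ⊆ (realizeBarycentres u).coord.support := by
  intro x hx
  refine Finsupp.mem_support_iff.2 (ne_of_gt ?_)
  change 0 < barycentreLinear Q u.coord x
  rw [barycentreLinear_apply_of_subset subset_rfl]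
  refine Finset.sum_pos' (fun B _ => mul_nonneg (u.nonneg B) (barycentre_nonneg B x)) ⟨A, hA, ?_⟩
  rw [barycentre_apply_of_mem hx]
  exact mul_pos ((u.nonneg A).lt_of_ne' (Finsupp.mem_support_iff.1 hA))
    (inv_pos.2 (card_pos_of_chain A))

theorem barycentre_chain (C : PosetInvolution Q) (A : ChainPoset Q) :
    barycentre (C.chain A) = Finsupp.mapDomain C (barycentre A) := by
  ext x
  have h : x ∈ (C.chain A).1 ↔ C x ∈ A.1 := by
    change x ∈ A.1.map C.emb ↔ _
    rw [Finset.mem_map]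
    constructor
    · rintro ⟨y, hy, rfl⟩
      change C (C y) ∈ A.1
      rwa [C.involutive y]
    · exact fun hx => ⟨C x, hx, C.involutive x⟩
  rw [C.mapDomain_apply]
  by_cases hx : C x ∈ A.1
  · rw [barycentre_apply_of_mem hx, barycentre_apply_of_mem (h.2 hx)]
    congr 2
    exact Finset.card_map _
  · rw [barycentre_apply_of_notMem hx, barycentre_apply_of_notMem (mt h.1 hx)]

theorem isEquivariant_realizeBarycentres (C : PosetInvolution Q) :
    IsEquivariant C.chain.realization C.realization realizeBarycentres := by
  have key : ∀ u : ChainPoset Q →₀ ℝ, barycentreLinear Q (Finsupp.mapDomain C.chain u) =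
      Finsupp.mapDomain C (barycentreLinear Q u) := by
    intro u
    induction u using Finsupp.induction_linear with
    | zero => simp
    | add f g hf hg => simp only [Finsupp.mapDomain_add, map_add, hf, hg]
    | single A a =>
      rw [Finsupp.mapDomain_single, barycentreLinear_single, barycentreLinear_single,
        Finsupp.mapDomain_smul, barycentre_chain]
  exact fun u => Realization.ext (key u.coord)

end Affine

/-! ### The coefficients of a preimage -/

section Gap

variable {Q : Type*} [PartialOrder Q]

open Classical in
/-- The number `|A| · max (0, min_A t - max_{σ \ A} t)`, where the maximum over the empty set
is `0`. It is written with the truncated subtraction of `ℝ≥0`, and is meant for `t` with values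
in `ℝ≥0`. -/
noncomputable def gap (σ : Finset Q) (A : ChainPoset Q) (t : Q → ℝ) : ℝ :=
  A.1.card * (A.1.inf' A.2.1 (fun x => (t x).toNNReal) -
    (σ \ A.1).sup (fun x => (t x).toNNReal) : NNReal)

theorem continuous_gap (σ : Finset Q) (A : ChainPoset Q) : Continuous (gap σ A) := by
  classical
  have h : ∀ x : Q, Continuous fun t : Q → ℝ => (t x).toNNReal := fun x =>
    continuous_real_toNNReal.comp (continuous_apply x)
  exact continuous_const.mul (NNReal.continuous_coe.comp
    ((Continuous.finset_inf'_apply _ fun x _ => h x).sub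
      (Continuous.finset_sup_apply fun x _ => h x)))

/-- If `A` is in the support of `u`, the image of `u` drops by at least `u A / |A|` from any
element of `A` to any element outside of `A`. -/
theorem coord_le_gap (u : Realization (orderComplex (ChainPoset Q))) (σ : Finset Q)
    (A : ChainPoset Q) : u.coord A ≤ gap σ A (realizeBarycentres u).coord := by
  classical
  by_cases hA : A ∈ u.coord.support
  swap
  · rw [Finsupp.notMem_support_iff.1 hA]
    exact mul_nonneg (Nat.cast_nonneg _) (NNReal.coe_nonneg _)
  have hc := card_pos_of_chain A
  set t := (realizeBarycentres u).coord
  have htx : ∀ x, t x = ∑ B ∈ u.coord.support, u.coord B * barycentre B x := fun x =>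
    barycentreLinear_apply_of_subset subset_rfl x
  have hterm : ∀ x (B : ChainPoset Q), 0 ≤ u.coord B * barycentre B x := fun x B =>
    mul_nonneg (u.nonneg B) (barycentre_nonneg B x)
  have hpos : ∀ x ∈ A.1, u.coord A / A.1.card ≤ t x := by
    intro x hx
    rw [htx]
    refine le_trans (le_of_eq ?_) (Finset.single_le_sum (fun B _ => hterm x B) hA)
    rw [barycentre_apply_of_mem hx, div_eq_mul_inv]
  have hdiff : ∀ x ∈ A.1, ∀ y ∉ A.1, u.coord A / A.1.card + t y ≤ t x := by
    intro x hx y hy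
    rw [htx, htx, ← Finset.add_sum_erase _ _ hA, ← Finset.add_sum_erase _ _ hA,
      barycentre_apply_of_mem hx, barycentre_apply_of_notMem hy, mul_zero, zero_add,
      div_eq_mul_inv]
    refine add_le_add le_rfl (Finset.sum_le_sum fun B hB => ?_)
    by_cases hyB : y ∈ B.1
    swap
    · rw [barycentre_apply_of_notMem hyB, mul_zero]
      exact hterm x B
    -- `B` is comparable to `A` and contains `y ∉ A`, so it contains `A`.
    have hAB : A.1 ⊆ B.1 :=
      (u.support_mem.2.total hA (Finset.mem_of_mem_erase hB)).elim (fun h => absurd (h hyB) hy) id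
    rw [barycentre_apply_of_mem hyB, barycentre_apply_of_mem (hAB hx)]
  have hle : (u.coord A / A.1.card).toNNReal ≤ A.1.inf' A.2.1 (fun x => (t x).toNNReal) -
      (σ \ A.1).sup (fun x => (t x).toNNReal) := by
    obtain ⟨x, hx, hinf⟩ := A.1.exists_mem_eq_inf' A.2.1 (fun x => (t x).toNNReal)
    rw [hinf]
    have h0 : (0 : ℝ) ≤ u.coord A / A.1.card := div_nonneg (u.nonneg A) hc.le
    have hxle := Real.toNNReal_le_toNNReal (hpos x hx)
    have hsup : (σ \ A.1).sup (fun x => (t x).toNNReal) ≤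
        (t x).toNNReal - (u.coord A / A.1.card).toNNReal := by
      refine Finset.sup_le fun y hy => le_tsub_of_add_le_left ?_
      rw [← Real.toNNReal_add h0 ((realizeBarycentres u).nonneg y)]
      exact Real.toNNReal_le_toNNReal (hdiff x hx y (Finset.mem_sdiff.1 hy).2)
    refine le_tsub_of_add_le_left ?_
    calc _ ≤ _ := add_le_add_left hsup _
      _ = _ := tsub_add_cancel_of_le hxle
  have := NNReal.coe_le_coe.2 hle
  rw [Real.coe_toNNReal _ (div_nonneg (u.nonneg A) hc.le), div_le_iff₀' hc] at this
  exact this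

end Gap

/-! ### The preimage given by a descending enumeration -/

section Descending

/-- The coefficients of `t` along the enumeration `x`, continued by `0`. -/
noncomputable def coeffAlong {V : Type*} {k : ℕ} (t : V → ℝ) (x : Fin k ↪ V) (n : ℕ) : ℝ :=
  if h : n < k then t (x ⟨n, h⟩) else 0

theorem coeffAlong_fin {V : Type*} {k : ℕ} (t : V → ℝ) (x : Fin k ↪ V) (j : Fin k) :
    coeffAlong t x j = t (x j) := by
  simp [coeffAlong]

theorem coeffAlong_self {V : Type*} {k : ℕ} (t : V → ℝ) (x : Fin k ↪ V) :
    coeffAlong t x k = 0 := by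
  simp [coeffAlong]

theorem coeffAlong_succ_le {V : Type*} {k : ℕ} {t : V → ℝ} {x : Fin k ↪ V} (h0 : ∀ q, 0 ≤ t q)
    (hanti : Antitone fun j => t (x j)) (j : Fin k) :
    coeffAlong t x (j + 1) ≤ coeffAlong t x j := by
  rw [coeffAlong_fin, coeffAlong]
  split_ifs with h
  · exact hanti (Fin.le_def.2 (Nat.le_succ j.1))
  · exact h0 _

/-- The coefficient `(j + 1) (t xⱼ - t xⱼ₊₁)` of the `j`-th prefix, where `t xₖ` is read
as `0`. -/
noncomputable def prefixCoeff {V : Type*} {k : ℕ} (t : V → ℝ) (x : Fin k ↪ V) (j : Fin k) : ℝ :=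
  (j + 1) * (coeffAlong t x j - coeffAlong t x (j + 1))

theorem prefixCoeff_nonneg {V : Type*} {k : ℕ} {t : V → ℝ} {x : Fin k ↪ V} (h0 : ∀ q, 0 ≤ t q)
    (hanti : Antitone fun j => t (x j)) (j : Fin k) : 0 ≤ prefixCoeff t x j :=
  mul_nonneg (by positivity) (sub_nonneg.2 (coeffAlong_succ_le h0 hanti j))

variable {Q : Type*} [PartialOrder Q]

theorem card_prefixChain {k : ℕ} (x : Fin k ↪ Q) (hx : IsChain (· ≤ ·) (Set.range x))
    (j : Fin k) : ((prefixChain x hx j).1.card : ℝ) = j + 1 := by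
  simp [prefixChain]

theorem mem_prefixChain {k : ℕ} {x : Fin k ↪ Q} {hx : IsChain (· ≤ ·) (Set.range x)}
    {i j : Fin k} : x i ∈ (prefixChain x hx j).1 ↔ i ≤ j := by
  simp [prefixChain]

/-- Abel summation: the prefix coefficients solve the equation that defines the canonical map. -/
theorem sum_prefixCoeff_smul_barycentre {k : ℕ} (t : Q →₀ ℝ) (x : Fin k ↪ Q)
    (hx : IsChain (· ≤ ·) (Set.range x)) (hsupp : (t.support : Set Q) ⊆ Set.range x) :
    ∑ j, prefixCoeff t x j • barycentre (prefixChain x hx j) = t := by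
  ext y
  rw [Finsupp.finsetSum_apply]
  simp only [Finsupp.smul_apply, smul_eq_mul]
  by_cases hy : y ∈ Set.range x
  · obtain ⟨i, rfl⟩ := hy
    have hterm : ∀ j : Fin k, prefixCoeff t x j * barycentre (prefixChain x hx j) (x i) =
        (fun n : ℕ => if i.1 ≤ n then coeffAlong t x n - coeffAlong t x (n + 1) else 0) j := by
      intro j
      by_cases hij : i ≤ j
      · rw [barycentre_apply_of_mem (mem_prefixChain.2 hij), card_prefixChain, prefixCoeff]
        have : (j : ℝ) + 1 ≠ 0 := by positivity
        simp only [Fin.le_def.1 hij, if_true]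
        field_simp
      · rw [barycentre_apply_of_notMem (mt mem_prefixChain.1 hij), mul_zero]
        exact (if_neg hij).symm
    rw [Finset.sum_congr rfl fun j _ => hterm j, Fin.sum_univ_eq_sum_range
        (fun n : ℕ => if i.1 ≤ n then coeffAlong t x n - coeffAlong t x (n + 1) else 0),
      ← Finset.sum_filter]
    have hIco : (Finset.range k).filter (fun n => i.1 ≤ n) = Finset.Ico i.1 k := by
      ext n; simp [and_comm]
    rw [hIco, Finset.sum_Ico_eq_sum_range]
    simp only [add_assoc]
    rw [Finset.sum_range_sub' (fun n => coeffAlong t x (i + n)), Nat.add_sub_cancel' i.2.le,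
      add_zero, coeffAlong_self, coeffAlong_fin, sub_zero]
  · rw [Finsupp.notMem_support_iff.1 (mt (@hsupp y) hy)]
    refine Finset.sum_eq_zero fun j _ => ?_
    rw [barycentre_apply_of_notMem, mul_zero]
    intro h
    obtain ⟨i, -, hi⟩ := Finset.mem_map.1 h
    exact hy ⟨i, hi⟩

theorem isChain_range_prefixChain {k : ℕ} (x : Fin k ↪ Q)
    (hx : IsChain (· ≤ ·) (Set.range x)) : IsChain (· ≤ ·) (Set.range (prefixChain x hx)) := by
  rintro _ ⟨i, rfl⟩ _ ⟨j, rfl⟩ -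
  rcases le_total i j with h | h
  · exact Or.inr (Finset.map_subset_map.2 (Finset.Iic_subset_Iic.2 h))
  · exact Or.inl (Finset.map_subset_map.2 (Finset.Iic_subset_Iic.2 h))

/-- The point over `t` that is supported on the prefixes of a descending enumeration. -/
noncomputable def descendingPoint (t : Realization (orderComplex Q)) {k : ℕ} (x : Fin k ↪ Q)
    (hx : IsChain (· ≤ ·) (Set.range x)) (hsupp : (t.coord.support : Set Q) ⊆ Set.range x)
    (hanti : Antitone fun j => t.coord (x j)) :
    Realization (orderComplex (ChainPoset Q)) where
  coord := ∑ j, Finsupp.single (prefixChain x hx j) (prefixCoeff t.coord x j)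
  nonneg A := by
    classical
    rw [Finsupp.finsetSum_apply]
    refine Finset.sum_nonneg fun j _ => ?_
    rw [Finsupp.single_apply]
    split_ifs
    exacts [prefixCoeff_nonneg t.nonneg hanti j, le_rfl]
  sum_eq_one := by
    rw [← coeffSum_apply, ← coeffSum_barycentreLinear, map_sum]
    simp only [barycentreLinear_single]
    rw [sum_prefixCoeff_smul_barycentre t.coord x hx hsupp, coeffSum_apply, t.sum_eq_one]
  support_mem := by
    classical
    refine ⟨Finsupp.support_nonempty_of_sum_eq_one ?_,
      (isChain_range_prefixChain x hx).mono fun A hA => ?_⟩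
    · rw [← coeffSum_apply, ← coeffSum_barycentreLinear, map_sum]
      simp only [barycentreLinear_single]
      rw [sum_prefixCoeff_smul_barycentre t.coord x hx hsupp, coeffSum_apply, t.sum_eq_one]
    · rw [Finset.mem_coe, Finsupp.mem_support_iff, Finsupp.finsetSum_apply] at hA
      obtain ⟨j, -, hj⟩ := Finset.exists_ne_zero_of_sum_ne_zero hA
      rw [Finsupp.single_apply] at hj
      exact ⟨j, by_contra fun h => hj (if_neg h)⟩

theorem realizeBarycentres_eq_of_coord {t : Realization (orderComplex Q)}
    {u : Realization (orderComplex (ChainPoset Q))} {k : ℕ} {x : Fin k ↪ Q}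
    {hx : IsChain (· ≤ ·) (Set.range x)} {s : Fin k → ℝ}
    (hs : ∑ j, s j • barycentre (prefixChain x hx j) = t.coord)
    (hu : u.coord = ∑ j, Finsupp.single (prefixChain x hx j) (s j)) :
    realizeBarycentres u = t := by
  refine Realization.ext ?_
  change barycentreLinear Q u.coord = t.coord
  rw [hu, map_sum, ← hs]
  simp only [barycentreLinear_single]

theorem realizeBarycentres_descendingPoint (t : Realization (orderComplex Q)) {k : ℕ}
    (x : Fin k ↪ Q) (hx : IsChain (· ≤ ·) (Set.range x))
    (hsupp : (t.coord.support : Set Q) ⊆ Set.range x)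
    (hanti : Antitone fun j => t.coord (x j)) :
    realizeBarycentres (descendingPoint t x hx hsupp hanti) = t :=
  realizeBarycentres_eq_of_coord (sum_prefixCoeff_smul_barycentre t.coord x hx hsupp) rfl

/-- A chain `A` with a positive gap consists of all points where `t` exceeds some level, so it is
a prefix `{x₀, …, xⱼ}` of every descending enumeration; its gap is then at most
`(j + 1) (t xⱼ - t xⱼ₊₁)`. -/
theorem gap_le_descending (t : Realization (orderComplex Q)) {k : ℕ}
    (x : Fin k ↪ Q) (hx : IsChain (· ≤ ·) (Set.range x))
    (hsupp : (t.coord.support : Set Q) ⊆ Set.range x)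
    (hanti : Antitone fun j => t.coord (x j)) {σ : Finset Q} (hσ : t.coord.support ⊆ σ)
    (A : ChainPoset Q) :
    gap σ A t.coord ≤ (descendingPoint t x hx hsupp hanti).coord A := by
  classical
  set m : NNReal := A.1.inf' A.2.1 (fun x => (t.coord x).toNNReal)
  set M : NNReal := (σ \ A.1).sup (fun x => (t.coord x).toNNReal)
  have hgap : gap σ A t.coord = A.1.card * ((m - M : NNReal) : ℝ) := rfl
  rcases le_or_gt m M with hle | hlt
  · rw [hgap, tsub_eq_zero_of_le hle]
    simpa using (descendingPoint t x hx hsupp hanti).nonneg A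
  have hmle : ∀ q ∈ A.1, (m : ℝ) ≤ t.coord q := fun q hq => by
    rw [← Real.coe_toNNReal _ (t.nonneg q), NNReal.coe_le_coe]
    exact Finset.inf'_le _ hq
  have hout : ∀ q ∉ A.1, t.coord q ≤ M := fun q hq => by
    by_cases hqs : q ∈ σ
    · rw [← Real.coe_toNNReal _ (t.nonneg q), NNReal.coe_le_coe]
      exact Finset.le_sup (f := fun x => (t.coord x).toNNReal) (Finset.mem_sdiff.2 ⟨hqs, hq⟩)
    · rw [Finsupp.notMem_support_iff.1 (mt (@hσ q) hqs)]
      exact M.2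
  have hltR : (M : ℝ) < m := NNReal.coe_lt_coe.2 hlt
  have hrange : ∀ q ∈ A.1, q ∈ Set.range x := fun q hq =>
    hsupp (Finsupp.mem_support_iff.2 (M.2.trans_lt (hltR.trans_le (hmle q hq))).ne')
  -- `A` is the prefix that ends at its last element.
  obtain ⟨j, hj, hjmax⟩ : ∃ j : Fin k, x j ∈ A.1 ∧ ∀ i, x i ∈ A.1 → i ≤ j := by
    obtain ⟨q, hq⟩ := A.2.1
    obtain ⟨i, rfl⟩ := hrange q hq
    obtain ⟨j, hj⟩ := (Finset.univ.filter fun i => x i ∈ A.1).exists_maximal ⟨i, by simpa using hq⟩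
    refine ⟨j, by simpa using hj.1, fun i hi => ?_⟩
    exact (le_total i j).elim id fun h => hj.2 (by simpa using hi) h
  have hAj : A = prefixChain x hx j := by
    refine Subtype.ext (Finset.ext fun q => ⟨fun hq => ?_, fun hq => ?_⟩)
    · obtain ⟨i, rfl⟩ := hrange q hq
      exact mem_prefixChain.2 (hjmax i hq)
    · obtain ⟨i, hi, rfl⟩ := Finset.mem_map.1 hq
      by_contra hiA
      have h1 : t.coord (x j) ≤ t.coord (x i) := hanti (Finset.mem_Iic.1 hi)
      linarith [hmle _ hj, hout _ hiA]
  have hnext : coeffAlong t.coord x (j + 1) ≤ M := by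
    rw [coeffAlong]
    split_ifs with h
    · exact hout _ fun hA => absurd (Fin.le_def.1 (hjmax _ hA)) (by simp)
    · exact M.2
  have hcoeff : gap σ A t.coord ≤ prefixCoeff t.coord x j := by
    rw [hgap, hAj, card_prefixChain, prefixCoeff, NNReal.coe_sub hlt.le, coeffAlong_fin]
    exact mul_le_mul_of_nonneg_left (sub_le_sub (hmle _ hj) hnext) (by positivity)
  refine hcoeff.trans ?_
  change _ ≤ (∑ i, Finsupp.single (prefixChain x hx i) (prefixCoeff t.coord x i)) A
  rw [Finsupp.finsetSum_apply]
  refine le_trans (le_of_eq ?_) (Finset.single_le_sum (fun i _ => ?_) (Finset.mem_univ j))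
  · rw [hAj, Finsupp.single_eq_same]
  · rw [Finsupp.single_apply]
    split_ifs
    exacts [prefixCoeff_nonneg t.nonneg hanti i, le_rfl]

theorem exists_descending_enumeration (t : Realization (orderComplex Q)) :
    ∃ (k : ℕ) (x : Fin k ↪ Q), IsChain (· ≤ ·) (Set.range x) ∧
      (t.coord.support : Set Q) ⊆ Set.range x ∧ Antitone fun j => t.coord (x j) := by
  let e := t.coord.support.equivFin.symm
  let f : Fin t.coord.support.card → ℝ := fun i => -t.coord (e i)
  refine ⟨_, ((Tuple.sort f).trans e).toEmbedding.trans (Function.Embedding.subtype _),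
    t.support_mem.2.mono ?_, fun q hq => ?_, fun i j hij => ?_⟩
  · rintro _ ⟨i, rfl⟩
    exact (((Tuple.sort f).trans e) i).2
  · exact ⟨((Tuple.sort f).trans e).symm ⟨q, hq⟩, by simp⟩
  · exact neg_le_neg_iff.1 (Tuple.monotone_sort f hij)

end Descending

/-! ### The canonical homeomorphism -/

section Homeomorphism

variable {Q : Type*} [PartialOrder Q]

/-- The coefficients of `u` can be recovered from its image: the gap at `A` lies between `u A`
and the coefficient at `A` of a point given by a descending enumeration, and the coefficients of
both points have sum one. -/
theorem coord_eq_gap (u : Realization (orderComplex (ChainPoset Q))) {σ : Finset Q}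
    (hσ : (realizeBarycentres u).coord.support ⊆ σ) (A : ChainPoset Q) :
    u.coord A = gap σ A (realizeBarycentres u).coord := by
  classical
  obtain ⟨k, x, hx, hsupp, hanti⟩ := exists_descending_enumeration (realizeBarycentres u)
  set v := descendingPoint (realizeBarycentres u) x hx hsupp hanti
  have hle : ∀ B, gap σ B (realizeBarycentres u).coord ≤ v.coord B :=
    gap_le_descending _ x hx hsupp hanti hσ
  have huv : ∀ B, u.coord B ≤ v.coord B := fun B => (coord_le_gap u σ B).trans (hle B)
  refine le_antisymm (coord_le_gap u σ A) ((hle A).trans (le_of_eq ?_))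
  by_cases hA : A ∈ u.coord.support ∪ v.coord.support
  · refine ((Finset.sum_eq_sum_iff_of_le fun B _ => huv B).1 ?_ A hA).symm
    rw [← Finsupp.sum_of_support_subset u.coord Finset.subset_union_left (fun _ a => a) (by simp),
      ← Finsupp.sum_of_support_subset v.coord Finset.subset_union_right (fun _ a => a) (by simp),
      u.sum_eq_one, v.sum_eq_one]
  · rw [Finset.mem_union, not_or] at hA
    rw [Finsupp.notMem_support_iff.1 hA.1, Finsupp.notMem_support_iff.1 hA.2]

theorem bijective_realizeBarycentres : Function.Bijective (realizeBarycentres (Q := Q)) := by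
  refine ⟨fun u v huv => Realization.ext (Finsupp.ext fun A => ?_), fun t => ?_⟩
  · rw [coord_eq_gap u subset_rfl, huv, coord_eq_gap v subset_rfl]
  · obtain ⟨k, x, hx, hsupp, hanti⟩ := exists_descending_enumeration t
    exact ⟨_, realizeBarycentres_descendingPoint t x hx hsupp hanti⟩

/-- `realizeBarycentres` as a bijection. -/
noncomputable def realizeBarycentresEquiv (Q : Type*) [PartialOrder Q] :
    Realization (orderComplex (ChainPoset Q)) ≃ Realization (orderComplex Q) :=
  Equiv.ofBijective _ bijective_realizeBarycentres

theorem realizeBarycentres_symm (t : Realization (orderComplex Q)) :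
    realizeBarycentres ((realizeBarycentresEquiv Q).symm t) = t :=
  (realizeBarycentresEquiv Q).apply_symm_apply t

theorem symm_coord_eq_gap {σ : Finset Q} (t : Realization.ClosedSimplex (orderComplex Q) σ)
    (A : ChainPoset Q) :
    ((realizeBarycentresEquiv Q).symm t.1).coord A = gap σ A t.1.coord := by
  have h := realizeBarycentres_symm t.1
  rw [coord_eq_gap (σ := σ) _ (by rw [h]; exact t.2), h]

theorem continuous_symm_coord (σ : Finset Q) (A : ChainPoset Q) :
    Continuous fun t : Realization.ClosedSimplex (orderComplex Q) σ =>
      ((realizeBarycentresEquiv Q).symm t.1).coord A := by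
  have h : Continuous fun t : Realization.ClosedSimplex (orderComplex Q) σ =>
      gap σ A t.1.coord :=
    (continuous_gap σ A).comp (continuous_pi fun x =>
      Realization.ClosedSimplex.continuous_coord σ x)
  exact h.congr fun t => (symm_coord_eq_gap t A).symm

theorem continuous_realizeBarycentresEquiv_symm :
    Continuous (realizeBarycentresEquiv Q).symm := by
  classical
  refine Realization.continuous_iff.2 fun σ _ => ?_
  -- The chains inside of `σ` are the only possible vertices of the image of the simplex `σ`.
  let P : Finset (ChainPoset Q) := σ.powerset.subtype (· ∈ (orderComplex Q).faces)
  let S : {τ // τ ∈ P.powerset ∧ τ ∈ (orderComplex (ChainPoset Q)).faces} →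
      Set (Realization.ClosedSimplex (orderComplex Q) σ) := fun τ =>
    {t | ((realizeBarycentresEquiv Q).symm t.1).coord.support ⊆ τ.1}
  have : Finite {τ // τ ∈ P.powerset ∧ τ ∈ (orderComplex (ChainPoset Q)).faces} :=
    P.powerset.finite_toSet.subset fun _ h => h.1
  refine LocallyFinite.continuous (f := S) (locallyFinite_of_finite S) ?_ (fun τ => ?_)
    fun τ => ?_
  · refine Set.eq_univ_of_forall fun t => Set.mem_iUnion.2
      ⟨⟨((realizeBarycentresEquiv Q).symm t.1).coord.support, ?_, Realization.support_mem _⟩,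
        Finset.Subset.refl _⟩
    refine Finset.mem_powerset.2 fun A hA => Finset.mem_subtype.2 (Finset.mem_powerset.2 ?_)
    have h := subset_support_realizeBarycentres _ hA
    rw [realizeBarycentres_symm] at h
    exact h.trans t.2
  · have hS : S τ = ⋂ (A : ChainPoset Q) (_ : A ∉ τ.1),
        {t | ((realizeBarycentresEquiv Q).symm t.1).coord A = 0} := by
      ext t
      simp only [S, Set.mem_ofPred_eq, Set.mem_iInter, Finset.subset_iff, Finsupp.mem_support_iff]
      exact forall_congr' fun A => not_imp_comm
    rw [hS]
    exact isClosed_iInter fun A => isClosed_iInter fun _ =>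
      isClosed_eq (continuous_symm_coord σ A) continuous_const
  · rw [continuousOn_iff_continuous_domRestrict]
    let g : S τ → Realization.ClosedSimplex (orderComplex (ChainPoset Q)) τ.1 := fun t =>
      ⟨(realizeBarycentresEquiv Q).symm t.1.1, t.2⟩
    have hg : Continuous g := continuous_induced_rng.2 (continuous_pi fun A =>
      (continuous_symm_coord σ A).comp continuous_subtype_val)
    exact (Realization.continuous_incl τ.2.2).comp hg

/-- The canonical map `|Δ(Q)| → |Δ(Chain(Q))|`, as the inverse of `realizeBarycentres`. -/
noncomputable def barycentricHomeomorph (Q : Type*) [PartialOrder Q] :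
    Realization (orderComplex Q) ≃ₜ Realization (orderComplex (ChainPoset Q)) where
  toEquiv := (realizeBarycentresEquiv Q).symm
  continuous_toFun := continuous_realizeBarycentresEquiv_symm
  continuous_invFun := continuous_realizeBarycentres

theorem isBarycentricMap_barycentricHomeomorph :
    IsBarycentricMap (barycentricHomeomorph Q) := by
  intro t k x hx hsupp hanti
  refine ⟨prefixCoeff t.coord x, sum_prefixCoeff_smul_barycentre t.coord x hx hsupp, ?_⟩
  have h : barycentricHomeomorph Q t = descendingPoint t x hx hsupp hanti :=
    bijective_realizeBarycentres.1 ((realizeBarycentres_symm t).trans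
      (realizeBarycentres_descendingPoint t x hx hsupp hanti).symm)
  rw [h]
  rfl

theorem IsBarycentricMap.eq_barycentricHomeomorph
    {Γ : Realization (orderComplex Q) → Realization (orderComplex (ChainPoset Q))}
    (hΓ : IsBarycentricMap Γ) : Γ = barycentricHomeomorph Q := by
  funext t
  obtain ⟨k, x, hx, hsupp, hanti⟩ := exists_descending_enumeration t
  obtain ⟨s, hs, hu⟩ := hΓ t k x hx hsupp hanti
  exact bijective_realizeBarycentres.1
    ((realizeBarycentres_eq_of_coord hs hu).trans (realizeBarycentres_symm t).symm)

theorem isEquivariant_barycentricHomeomorph (C : PosetInvolution Q) :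
    IsEquivariant C.realization C.chain.realization (barycentricHomeomorph Q) := by
  intro t
  refine bijective_realizeBarycentres.1 ((realizeBarycentres_symm _).trans ?_)
  rw [isEquivariant_realizeBarycentres C]
  exact congrArg C.realization (realizeBarycentres_symm t).symm

end Homeomorphism

/-- An equivariant homeomorphism is a `ℤ/2`-equivalence. -/
theorem IsEquivariant.isZ2Equivalence {X Y : Type*} [TopologicalSpace X] [TopologicalSpace Y]
    {ωX : Z2Action X} {ωY : Z2Action Y} {e : X ≃ₜ Y} (he : IsEquivariant ωX ωY e) :
    IsZ2Equivalence ωX ωY (e : C(X, Y)) := by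
  refine ⟨he, (e.symm : C(Y, X)), fun y => ?_, ?_, ?_⟩
  · apply e.injective
    have h := he (e.symm y)
    simp only [Homeomorph.apply_symm_apply] at h
    simpa using h.symm
  · have h : (e.symm : C(Y, X)).comp (e : C(X, Y)) = ContinuousMap.id X :=
      ContinuousMap.ext e.symm_apply_apply
    rw [h]
    exact ContinuousMap.HomotopicWith.refl _ fun _ => rfl
  · have h : (e : C(X, Y)).comp (e.symm : C(Y, X)) = ContinuousMap.id Y :=
      ContinuousMap.ext e.apply_symm_apply
    rw [h]
    exact ContinuousMap.HomotopicWith.refl _ fun _ => rfl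

theorem mainTheorem12 {Q : Type*} [PartialOrder Q] (C : PosetInvolution Q) :
    (∃ Γ : Realization (orderComplex Q) ≃ₜ Realization (orderComplex (ChainPoset Q)),
      IsBarycentricMap Γ ∧
      (∀ Γ' : Realization (orderComplex Q) → Realization (orderComplex (ChainPoset Q)),
        IsBarycentricMap Γ' → Γ' = Γ) ∧
      IsEquivariant C.realization C.chain.realization Γ ∧
      IsZ2Equivalence C.realization C.chain.realization
        (Γ : C(Realization (orderComplex Q), Realization (orderComplex (ChainPoset Q))))) ∧
    Z2HomotopyEquivalent C.realization C.chain.realization :=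
  have h := isEquivariant_barycentricHomeomorph C
  ⟨⟨barycentricHomeomorph Q, isBarycentricMap_barycentricHomeomorph,
    fun _ hΓ => hΓ.eq_barycentricHomeomorph, h, h.isZ2Equivalence⟩, _, h.isZ2Equivalence⟩
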